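/- Let $S$ be a right LCM monoid, that is, a left cancellative monoid in which the intersection of two principal right ideals is either empty or a principal right ideal. For $s,t\in S$ write $s\Cap t$ if $sS\cap tS\neq\emptyset$ and $s\perp t$ otherwise. Let $S_c=\{a\in S : a\Cap s \text{ for all } s\in S\}$ be the core of $S$, and write $s\sim t$ (core equivalence) if $sa=tb$ for some $a,b\in S_c$. A generalized scale on $S$ is a nontrivial monoid homomorphism $N\colon S\to\mathbb{N}^\times$, $s\mapsto N_s$, into the multiplicative monoid of positive integers such that $|N^{-1}(n)/_\sim|=n$ for all $n\in N(S)$; $N_s=N_t$ implies $s\sim t$ or $s\perp t$; and for all $s\in S$, $n\in N(S)$ there is $t\in N^{-1}(n)$ with $s\Cap t$. An element $s\in S\setminus S_c$ is noncore irreducible if $sa=tr$ with $a\in S_c$, $t,r\in S$ implies $t\in S_c$ or $r\in S_c$; let $\mathcal{I}(S)$ be the set of these elements. The core graph $\Gamma(S)$ has vertex set $\mathcal{I}(S)/_\sim$, and two distinct vertices $[s],[t]$ are joined by an edge if and only if $s\Cap t$. Let $\Gamma_i$, $i\in I$, with vertex sets $V_i$, be its coconnected components: the $V_i$ are the vertex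 sets of the connected components of the complementary graph, and $\Gamma_i$ is the subgraph of $\Gamma(S)$ induced on $V_i$. For $s\in\mathcal{I}(S)$ let $i(s)\in I$ be the index with $[s]\in V_{i(s)}$. Then $S$ admits a generalized scale if and only if the following four conditions hold: (i) the family $(|V_i|)_{i\in I}$ consists of positive integers and freely generates (as a commutative monoid with basis indexed by $I$) a nontrivial submonoid of $\mathbb{N}^\times$; (ii) the coconnected components $\Gamma_i$ are edge-free; (iii) $S$ is noncore factorable: every $s\in S\setminus S_c$ is core equivalent to a finite product of elements of $\mathcal{I}(S)$; (iv) $S$ has balanced factorization: whenever $s,t\in\mathcal{I}(S)$ satisfy $i(s)\neq i(t)$, there are $s',t'\in\mathcal{I}(S)$ with $sS\cap tS=st'S$, $st'=ts'$, $i(s')=i(s)$ and $i(t')=i(t)$. If (i)--(iv) hold, then the generalized scale $N$ on $S$ is unique, it satisfies $N_s=|V_i|$ for all noncore irreducible $s$ with $[s]\in V_i$, and it is the only monoid homomorphism $S\to\mathbb{N}^\times$ with this property. -/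

import Mathlib

namespace RightLCM

section Basic

variable {S : Type*} [Monoid S]

/-- The principal right ideal `sS`. -/
def rightIdeal (s : S) : Set S := Set.range fun x => s * x

/-- `s ⋒ t`: the principal right ideals `sS` and `tS` intersect. -/
def Meets (s t : S) : Prop := (rightIdeal s ∩ rightIdeal t).Nonempty

/-- `s ⊥ t`: orthogonality. -/
def Orthogonal (s t : S) : Prop := ¬ Meets s t

variable (S) in
/-- The core `S_c` of all elements `a` with `a ⋒ s` for every `s`. -/
def core : Set S := {a | ∀ s : S, Meets a s}

/-- Core equivalence `s ∼ t`: there are `a, b` in the core with `sa = tb`. -/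
def CoreEquiv (s t : S) : Prop := ∃ a ∈ core S, ∃ b ∈ core S, s * a = t * b

/-- Noncore irreducible elements. -/
def IsNoncoreIrreducible (s : S) : Prop :=
  s ∉ core S ∧ ∀ a ∈ core S, ∀ t r : S, s * a = t * r → t ∈ core S ∨ r ∈ core S

variable (S) in
/-- The set `I(S)` of noncore irreducible elements, as a type. -/
abbrev NoncoreIrreducible := {s : S // IsNoncoreIrreducible s}

end Basic

end RightLCM

/-- A right LCM monoid: a left cancellative monoid in which the intersection of two principal
right ideals is either empty or a principal right ideal. -/
class RightLCMMonoid (S : Type*) extends LeftCancelMonoid S where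
  inter_eq : ∀ s t : S, RightLCM.rightIdeal s ∩ RightLCM.rightIdeal t = ∅ ∨
    ∃ r : S, RightLCM.rightIdeal s ∩ RightLCM.rightIdeal t = RightLCM.rightIdeal r

namespace RightLCM

section CoreEquivalence

variable {S : Type*} [RightLCMMonoid S]

theorem one_mem_core : (1 : S) ∈ core S := fun s => ⟨s, ⟨s, by simp⟩, ⟨1, by simp⟩⟩

theorem mul_mem_core {a b : S} (ha : a ∈ core S) (hb : b ∈ core S) : a * b ∈ core S := by
  intro s
  obtain ⟨_, ⟨p, rfl⟩, ⟨q, hq⟩⟩ := ha s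
  obtain ⟨_, ⟨e, rfl⟩, ⟨f, hf⟩⟩ := hb p
  refine ⟨a * b * e, ⟨e, rfl⟩, ⟨q * f, ?_⟩⟩
  simp only at hq hf ⊢
  rw [← mul_assoc, hq, mul_assoc, hf, mul_assoc]

theorem mem_core_of_inter_eq {a s b : S} (ha : a ∈ core S)
    (h : rightIdeal s ∩ rightIdeal a ⊆ rightIdeal (s * b)) : b ∈ core S := by
  intro t
  obtain ⟨_, ⟨p, rfl⟩, ⟨q, hq⟩⟩ := ha (s * t)
  simp only at hq
  obtain ⟨y, hy⟩ := h (a := a * p) ⟨⟨t * q, by simp only; rw [← mul_assoc, hq]⟩, ⟨p, rfl⟩⟩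
  simp only at hy
  refine ⟨b * y, ⟨y, rfl⟩, ⟨q, ?_⟩⟩
  simp only
  apply mul_left_cancel (a := s)
  rw [← mul_assoc, hq, ← hy, mul_assoc]

theorem coreEquiv_equivalence : Equivalence (CoreEquiv (S := S)) where
  refl s := ⟨1, one_mem_core, 1, one_mem_core, rfl⟩
  symm := fun ⟨a, ha, b, hb, h⟩ => ⟨b, hb, a, ha, h.symm⟩
  trans := by
    rintro s t r ⟨a, ha, b, hb, h⟩ ⟨c, hc, d, hd, h'⟩
    rcases RightLCMMonoid.inter_eq b c with h0 | ⟨u, hu⟩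
    · exact absurd h0 (hb c).ne_empty
    · have hmem : u ∈ rightIdeal b ∩ rightIdeal c := hu ▸ ⟨1, by simp⟩
      obtain ⟨⟨x, rfl⟩, ⟨y, hy⟩⟩ := hmem
      simp only at hy hu
      have hx : x ∈ core S := mem_core_of_inter_eq hc hu.subset
      have hy' : y ∈ core S := by
        refine mem_core_of_inter_eq hb (s := c) ?_
        rw [hy, Set.inter_comm]
        exact hu.subset
      refine ⟨a * x, mul_mem_core ha hx, d * y, mul_mem_core hd hy', ?_⟩
      rw [← mul_assoc, h, mul_assoc, ← hy, ← mul_assoc, h', mul_assoc]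

end CoreEquivalence

variable (S : Type*) [RightLCMMonoid S]

/-- Core equivalence as a setoid on `S`. -/
def coreSetoid : Setoid S := ⟨CoreEquiv, coreEquiv_equivalence⟩

/-- A generalized scale: a nontrivial homomorphism `N : S → ℕ^×` into the multiplicative monoid of
positive integers such that (i) `N⁻¹(n)` consists of exactly `n` core equivalence classes for every
`n` in the image; (ii) `N s = N t` implies `s ∼ t` or `s ⊥ t`; (iii) for every `s` and every `n` in
the image there is `t ∈ N⁻¹(n)` with `s ⋒ t`. -/
structure IsGeneralizedScale (N : S →* ℕ+) : Prop where
  nontrivial : ∃ s : S, N s ≠ 1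
  encard_classes : ∀ n ∈ Set.range N,
    ((Quotient.mk (coreSetoid S)) '' (N ⁻¹' {n})).encard = ((n : ℕ) : ℕ∞)
  equiv_or_orthogonal : ∀ s t : S, N s = N t → CoreEquiv s t ∨ Orthogonal s t
  exists_meets : ∀ s : S, ∀ n ∈ Set.range N, ∃ t : S, N t = n ∧ Meets s t

/-- Core equivalence restricted to the noncore irreducible elements. -/
def irreducibleSetoid : Setoid (NoncoreIrreducible S) :=
  Setoid.comap Subtype.val (coreSetoid S)

/-- The vertex set `I(S)/∼` of the core graph. -/
def Vertex : Type _ := Quotient (irreducibleSetoid S)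

variable {S} in
/-- The vertex `[s]`. -/
def vertex (s : NoncoreIrreducible S) : Vertex S := Quotient.mk (irreducibleSetoid S) s

/-- The core graph `Γ(S)`: distinct vertices `[s]`, `[t]` are joined by an edge when `s ⋒ t`
(the loops at the vertices are not recorded). -/
def coreGraph : SimpleGraph (Vertex S) where
  Adj v w := v ≠ w ∧ ∃ s t : NoncoreIrreducible S,
    vertex s = v ∧ vertex t = w ∧ Meets (s : S) (t : S)
  symm := ⟨by
    rintro v w ⟨hne, s, t, hs, ht, x, hx⟩
    exact ⟨hne.symm, t, s, ht, hs, x, hx.symm⟩⟩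
  loopless := ⟨fun _ h => h.1 rfl⟩

/-- The index set `I` of the coconnected components of `Γ(S)`, that is, of the connected
components of the complementary graph. -/
abbrev CoComponent : Type _ := (coreGraph S)ᶜ.ConnectedComponent

variable {S} in
/-- The vertex set `V_i` of the coconnected component `Γ_i`. -/
def CoComponent.verts (i : CoComponent S) : Set (Vertex S) :=
  SimpleGraph.ConnectedComponent.supp i

variable {S} in
/-- The index `i(s)` of the coconnected component containing `[s]`. -/
def coIndex (s : NoncoreIrreducible S) : CoComponent S :=
  (coreGraph S)ᶜ.connectedComponentMk (vertex s)

/-- The family `(|V_i|)_{i ∈ I}` freely generates a nontrivial submonoid of `ℕ^×`: all `V_i` are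
finite and nonempty, finite products of the `|V_i|` determine the multiset of their factors'
indices, and the submonoid that the `|V_i|` generate is not `{1}`. -/
def FreelyGenerates : Prop :=
  ∃ n : CoComponent S → ℕ+,
    (∀ i, i.verts.encard = ((n i : ℕ) : ℕ∞)) ∧
    Function.Injective (fun m : Multiset (CoComponent S) => (m.map n).prod) ∧
    Submonoid.closure (Set.range n) ≠ ⊥

/-- Every coconnected component `Γ_i` is edge-free. -/
def EdgeFreeCoComponents : Prop :=
  ∀ i : CoComponent S, ∀ v ∈ i.verts, ∀ w ∈ i.verts, ¬ (coreGraph S).Adj v w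

/-- Every noncore element is core equivalent to a finite product of noncore irreducibles. -/
def NoncoreFactorable : Prop :=
  ∀ s : S, s ∉ core S →
    ∃ l : List (NoncoreIrreducible S), CoreEquiv s (l.map Subtype.val).prod

/-- Balanced factorization. -/
def BalancedFactorization : Prop :=
  ∀ s t : NoncoreIrreducible S, coIndex s ≠ coIndex t →
    ∃ s' t' : NoncoreIrreducible S,
      rightIdeal (s : S) ∩ rightIdeal (t : S) = rightIdeal ((s : S) * t') ∧
      (s : S) * t' = (t : S) * s' ∧
      coIndex s' = coIndex s ∧ coIndex t' = coIndex t

end RightLCM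

/-!
Suppose first that `N` is a generalized scale. Its kernel is the core, and two elements with the
same value that meet are core equivalent. If `s` meets `t` and `N s = N t * m` with `m` in the image
of `N`, then `s ∼ t * u` for some `u` of value `m` (`exists_coreEquiv_mul`): so factorizations of
values lift to factorizations of elements. In particular the noncore irreducible elements are
exactly those with irreducible value, and every noncore element factors into them. If `s`, `t` are
noncore irreducible with different values, then any right least common multiple of them has value
`N s * N t` (`map_eq_of_isRightLcm`). Counting the finitely many classes of value `N t` shows that
such `s` and `t` always meet (`meets_of_map_ne`). Hence the coconnected components of the core graph
are the fibres of `N` on noncore irreducible elements, they are edge-free, the number of vertices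
is the value of `N`, and irreducible values are prime in the image of `N` (`exists_map_eq_mul`),
which gives freeness.

Conversely, under the four conditions every element has a type: the multiset of components of the
factors in a factorization up to core equivalence. The difficulty is that core equivalence is not
compatible with right multiplication, so core elements have to be moved past irreducible factors.
Translation by a core element is an automorphism of the core graph, and it fixes all components
because these have pairwise different cardinalities (`coIndex_coreMul`); so types are insensitive
to core factors (`HasType.core_mul_iff`). Balanced factorization gives an exchange argument
(`HasType.exists_eq_cons`) that proves types unique, and, with the finiteness of the components,
allows any factor to be brought to the front (`HasType.exists_of_mem`). Types are additive, so
mapping `s` to the product of the cardinalities of the components in its type is a homomorphism. By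
freeness its fibres consist of the elements of a given type, and the axioms of a generalized scale
follow by induction on the type.

Uniqueness holds because a homomorphism with the prescribed values on the noncore irreducible
elements is trivial on the core, which acts on these elements preserving the values
(`monoidHom_eq_of_map_eq_encard`), while a generalized scale has the prescribed values
(`IsGeneralizedScale.encard_verts`).
-/

namespace RightLCM

/-! ### Principal right ideals, the core and core equivalence -/

section Core

variable {S : Type*} [RightLCMMonoid S]

theorem meets_iff {s t : S} : Meets s t ↔ ∃ x y, s * x = t * y := by
  constructor
  · rintro ⟨_, ⟨x, rfl⟩, ⟨y, hy⟩⟩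
    exact ⟨x, y, hy.symm⟩
  · rintro ⟨x, y, h⟩
    exact ⟨s * x, ⟨x, rfl⟩, ⟨y, h.symm⟩⟩

theorem Meets.symm {s t : S} (h : Meets s t) : Meets t s := by
  obtain ⟨x, y, h⟩ := meets_iff.1 h
  exact meets_iff.2 ⟨y, x, h.symm⟩

theorem Meets.of_mul_left {s x t : S} (h : Meets (s * x) t) : Meets s t := by
  obtain ⟨y, z, h⟩ := meets_iff.1 h
  exact meets_iff.2 ⟨x * y, z, by rw [← mul_assoc, h]⟩

theorem meets_mul_left_iff {r s t : S} : Meets (r * s) (r * t) ↔ Meets s t := by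
  simp [meets_iff, mul_assoc]

theorem left_mem_core {a b : S} (h : a * b ∈ core S) : a ∈ core S :=
  fun s => (h s).of_mul_left

theorem right_mem_core {a b : S} (h : a * b ∈ core S) : b ∈ core S :=
  fun s => meets_mul_left_iff.1 (h (a * s))

theorem CoreEquiv.refl (s : S) : CoreEquiv s s := coreEquiv_equivalence.refl s

theorem CoreEquiv.symm {s t : S} (h : CoreEquiv s t) : CoreEquiv t s :=
  coreEquiv_equivalence.symm h

theorem CoreEquiv.trans {s t r : S} (h : CoreEquiv s t) (h' : CoreEquiv t r) : CoreEquiv s r :=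
  coreEquiv_equivalence.trans h h'

theorem coreEquiv_mul_core (s : S) {a : S} (ha : a ∈ core S) : CoreEquiv (s * a) s :=
  ⟨1, one_mem_core, a, ha, by simp⟩

theorem coreEquiv_of_mem_core {a b : S} (ha : a ∈ core S) (hb : b ∈ core S) : CoreEquiv a b := by
  have h := (coreEquiv_mul_core 1 ha).trans (coreEquiv_mul_core 1 hb).symm
  simpa using h

theorem CoreEquiv.mul_left (r : S) {s t : S} (h : CoreEquiv s t) : CoreEquiv (r * s) (r * t) := by
  obtain ⟨a, ha, b, hb, h⟩ := h
  exact ⟨a, ha, b, hb, by rw [mul_assoc, h, mul_assoc]⟩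

theorem CoreEquiv.of_mul_left {r s t : S} (h : CoreEquiv (r * s) (r * t)) : CoreEquiv s t := by
  obtain ⟨a, ha, b, hb, h⟩ := h
  exact ⟨a, ha, b, hb, mul_left_cancel (a := r) (by simpa [mul_assoc] using h)⟩

theorem CoreEquiv.meets_of_meets {s s' t : S} (h : CoreEquiv s s') (hs : Meets s t) :
    Meets s' t := by
  obtain ⟨a, ha, b, hb, h⟩ := h
  obtain ⟨x, y, hxy⟩ := meets_iff.1 hs
  obtain ⟨p, q, hpq⟩ := meets_iff.1 (ha x)
  refine meets_iff.2 ⟨b * p, y * q, ?_⟩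
  rw [← mul_assoc, ← h, mul_assoc, hpq, ← mul_assoc, hxy, mul_assoc]

theorem CoreEquiv.meets {s t : S} (h : CoreEquiv s t) : Meets s t := by
  obtain ⟨a, _, b, _, h⟩ := h
  exact meets_iff.2 ⟨a, b, h⟩

theorem CoreEquiv.mem_core {s t : S} (h : CoreEquiv s t) (hs : s ∈ core S) : t ∈ core S :=
  fun r => h.meets_of_meets (hs r)

/-- `s * p = t * q` is a right least common multiple of `s` and `t`. -/
def IsRightLcm (s t p q : S) : Prop :=
  s * p = t * q ∧ ∀ x y, s * x = t * y → ∃ z, x = p * z ∧ y = q * z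

theorem isRightLcm_iff {s t p q : S} : IsRightLcm s t p q ↔
    rightIdeal s ∩ rightIdeal t = rightIdeal (s * p) ∧ s * p = t * q := by
  constructor
  · rintro ⟨h, hu⟩
    refine ⟨Set.Subset.antisymm ?_ ?_, h⟩
    · rintro _ ⟨⟨x, rfl⟩, ⟨y, hy⟩⟩
      obtain ⟨z, rfl, rfl⟩ := hu x y hy.symm
      exact ⟨z, mul_assoc _ _ _⟩
    · rintro _ ⟨z, rfl⟩
      exact ⟨⟨p * z, (mul_assoc _ _ _).symm⟩, ⟨q * z, by simp only [h, mul_assoc]⟩⟩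
  · rintro ⟨hI, h⟩
    refine ⟨h, fun x y hxy => ?_⟩
    obtain ⟨z, hz⟩ : s * x ∈ rightIdeal (s * p) := hI ▸ ⟨⟨x, rfl⟩, ⟨y, hxy.symm⟩⟩
    simp only at hz
    refine ⟨z, mul_left_cancel (a := s) (by rw [← hz, mul_assoc]),
      mul_left_cancel (a := t) (by rw [← hxy, ← hz, h, mul_assoc])⟩

theorem Meets.exists_isRightLcm {s t : S} (h : Meets s t) : ∃ p q, IsRightLcm s t p q := by
  rcases RightLCMMonoid.inter_eq s t with h0 | ⟨r, hr⟩
  · exact absurd h0 h.ne_empty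
  · obtain ⟨⟨p, rfl⟩, ⟨q, hq⟩⟩ : r ∈ rightIdeal s ∩ rightIdeal t := hr ▸ ⟨1, by simp⟩
    exact ⟨p, q, isRightLcm_iff.2 ⟨hr, hq.symm⟩⟩

theorem IsRightLcm.mem_core {a t p q : S} (h : IsRightLcm a t p q) (ha : a ∈ core S) :
    q ∈ core S := by
  obtain ⟨hI, hpq⟩ := isRightLcm_iff.1 h
  refine mem_core_of_inter_eq (s := t) ha ?_
  rw [Set.inter_comm, hI, hpq]

theorem IsRightLcm.mem_core_of_coreEquiv {s t p q : S} (h : IsRightLcm s t p q)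
    (hst : CoreEquiv s t) : p ∈ core S ∧ q ∈ core S := by
  obtain ⟨a, ha, b, hb, hab⟩ := hst
  obtain ⟨z, rfl, rfl⟩ := h.2 a b hab
  exact ⟨left_mem_core ha, left_mem_core hb⟩

/-- Core elements can be moved past any element, at the cost of changing that element. -/
theorem exists_isRightLcm_of_mem_core {a : S} (ha : a ∈ core S) (t : S) :
    ∃ p q, IsRightLcm a t p q ∧ q ∈ core S := by
  obtain ⟨p, q, h⟩ := (ha t).exists_isRightLcm
  exact ⟨p, q, h, h.mem_core ha⟩

end Core

/-! ### Noncore irreducible elements and the core graph -/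

section Irreducible

variable {S : Type*} [RightLCMMonoid S]

theorem IsNoncoreIrreducible.of_coreEquiv {s t : S} (hs : IsNoncoreIrreducible s)
    (h : CoreEquiv s t) : IsNoncoreIrreducible t := by
  refine ⟨fun ht => hs.1 (h.symm.mem_core ht), fun c hc u v huv => ?_⟩
  obtain ⟨a, ha, b, hb, hab⟩ := h
  obtain ⟨x, y, hxy, hy⟩ := exists_isRightLcm_of_mem_core hb c
  have hx : x ∈ core S := right_mem_core (a := b) (hxy.1 ▸ mul_mem_core hc hy)
  refine (hs.2 (a * x) (mul_mem_core ha hx) u (v * y) ?_).imp_right left_mem_core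
  rw [← mul_assoc, hab, mul_assoc, hxy.1, ← mul_assoc, huv, mul_assoc]

theorem isNoncoreIrreducible_core_mul_iff {a s : S} (ha : a ∈ core S) :
    IsNoncoreIrreducible (a * s) ↔ IsNoncoreIrreducible s := by
  constructor
  · rintro ⟨h, h'⟩
    refine ⟨fun hs => h (mul_mem_core ha hs), fun c hc t r htr => ?_⟩
    exact (h' c hc (a * t) r (by rw [mul_assoc, htr, mul_assoc])).imp_left right_mem_core
  · rintro ⟨h, h'⟩
    refine ⟨fun hs => h (right_mem_core hs), fun c hc t r htr => ?_⟩
    obtain ⟨p, q, hpq, hq⟩ := exists_isRightLcm_of_mem_core ha t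
    obtain ⟨z, hz, rfl⟩ := hpq.2 (s * c) r (by rw [← htr, mul_assoc])
    refine (h' c hc p z hz).imp (fun hp => ?_) (fun hz => mul_mem_core hq hz)
    exact left_mem_core (b := q) (hpq.1 ▸ mul_mem_core ha hp)

/-- The translate `as` of a noncore irreducible element by a core element `a`. -/
def coreMul {a : S} (ha : a ∈ core S) (s : NoncoreIrreducible S) : NoncoreIrreducible S :=
  ⟨a * s, (isNoncoreIrreducible_core_mul_iff ha).2 s.2⟩

theorem vertex_eq_iff {s t : NoncoreIrreducible S} :
    vertex s = vertex t ↔ CoreEquiv (s : S) (t : S) :=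
  ⟨fun h => Quotient.exact h, fun h => Quotient.sound h⟩

theorem exists_vertex_eq (v : Vertex S) : ∃ s : NoncoreIrreducible S, vertex s = v :=
  Quotient.exists_rep v

theorem coreGraph_adj_iff {s t : NoncoreIrreducible S} :
    (coreGraph S).Adj (vertex s) (vertex t) ↔
      ¬ CoreEquiv (s : S) (t : S) ∧ Meets (s : S) (t : S) := by
  constructor
  · rintro ⟨hne, s', t', hs, ht, h⟩
    rw [vertex_eq_iff] at hs ht
    exact ⟨fun h => hne (vertex_eq_iff.2 h),
      (ht.meets_of_meets (hs.meets_of_meets h).symm).symm⟩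
  · rintro ⟨hne, h⟩
    exact ⟨fun h => hne (vertex_eq_iff.1 h), s, t, rfl, rfl, h⟩

theorem mem_verts_iff {i : CoComponent S} {s : NoncoreIrreducible S} :
    vertex s ∈ i.verts ↔ coIndex s = i := Iff.rfl

theorem exists_coIndex_eq (i : CoComponent S) : ∃ s : NoncoreIrreducible S, coIndex s = i := by
  obtain ⟨v, rfl⟩ := i.exists_rep
  obtain ⟨s, rfl⟩ := exists_vertex_eq v
  exact ⟨s, rfl⟩

theorem coIndex_eq_of_coreEquiv {s t : NoncoreIrreducible S} (h : CoreEquiv (s : S) (t : S)) :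
    coIndex s = coIndex t := by
  rw [coIndex, coIndex, vertex_eq_iff.2 h]

theorem meets_of_coIndex_ne {s t : NoncoreIrreducible S} (h : coIndex s ≠ coIndex t) :
    Meets (s : S) (t : S) := by
  by_contra hst
  refine h (SimpleGraph.ConnectedComponent.sound (SimpleGraph.Adj.reachable ?_))
  refine (SimpleGraph.compl_adj _ _ _).2 ⟨fun hv => h ?_, fun ha => hst (coreGraph_adj_iff.1 ha).2⟩
  exact coIndex_eq_of_coreEquiv (vertex_eq_iff.1 hv)

end Irreducible

/-- An injective self-map of a finite set of equivalence classes, given on representatives, is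
surjective. -/
theorem exists_rel_of_finite_image_mk {α : Type*} (σ : Setoid α) (P : Set α)
    (hP : ∀ x y, σ x y → x ∈ P → y ∈ P) (hfin : (Quotient.mk σ '' P).Finite) (g : α → α)
    (hgP : ∀ x ∈ P, g x ∈ P) (hg : ∀ x ∈ P, ∀ y ∈ P, σ (g x) (g y) → σ x y) :
    ∀ t ∈ P, ∃ u ∈ P, σ (g u) t := by
  intro t ht
  have hout : ∀ q ∈ Quotient.mk σ '' P, q.out ∈ P := by
    rintro _ ⟨x, hx, rfl⟩
    exact hP x _ (σ.symm (Quotient.mk_out x)) hx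
  have hmaps : Set.MapsTo (fun q : Quotient σ => Quotient.mk σ (g q.out))
      (Quotient.mk σ '' P) (Quotient.mk σ '' P) :=
    fun q hq => ⟨_, hgP _ (hout q hq), rfl⟩
  have hinj : Set.InjOn (fun q : Quotient σ => Quotient.mk σ (g q.out)) (Quotient.mk σ '' P) := by
    intro q hq q' hq' h
    have := Quotient.sound (hg _ (hout q hq) _ (hout q' hq') (Quotient.exact h))
    rwa [Quotient.out_eq, Quotient.out_eq] at this
  obtain ⟨q, hq, h⟩ := ((hfin.injOn_iff_bijOn_of_mapsTo hmaps).1 hinj).surjOn ⟨t, ht, rfl⟩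
  exact ⟨q.out, hout q hq, Quotient.exact h⟩

/-! ### The structure imposed by a generalized scale -/

section Scale

variable {S : Type*} [RightLCMMonoid S]

namespace IsGeneralizedScale

variable {N : S →* ℕ+} (hN : IsGeneralizedScale S N)
include hN

theorem coreEquiv_of_meets {s t : S} (h : N s = N t) (hst : Meets s t) : CoreEquiv s t :=
  (hN.equiv_or_orthogonal s t h).resolve_right fun h => h hst

/-- The kernel of a generalized scale is the core: the fibre of `1` is a single class, and the
fibre of `N a` for a core element `a` is a single class as well, since all its elements meet
`a`. -/
theorem eq_one_iff {a : S} : N a = 1 ↔ a ∈ core S := by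
  constructor
  · intro ha
    have h := hN.coreEquiv_of_meets (s := 1) (t := a) (by rw [ha, map_one])
      (meets_iff.2 ⟨a, 1, by simp⟩)
    exact h.mem_core one_mem_core
  · intro ha
    have himg : Quotient.mk (coreSetoid S) '' (N ⁻¹' {N a}) = {Quotient.mk (coreSetoid S) a} := by
      refine Set.Subset.antisymm ?_ ?_
      · rintro _ ⟨t, ht, rfl⟩
        exact Quotient.sound (hN.coreEquiv_of_meets ht (ha t).symm)
      · rintro _ rfl
        exact ⟨a, rfl, rfl⟩
    have h := hN.encard_classes (N a) ⟨a, rfl⟩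
    rw [himg, Set.encard_singleton] at h
    exact PNat.eq (by exact_mod_cast h.symm)

theorem eq_of_coreEquiv {s t : S} (h : CoreEquiv s t) : N s = N t := by
  obtain ⟨a, ha, b, hb, h⟩ := h
  simpa [hN.eq_one_iff.2 ha, hN.eq_one_iff.2 hb] using congrArg N h

/-- The element `t` with `N t = k` divides `s` up to core equivalence as soon as it meets `s` and
`k` divides `N s` within the image of `N`: the complement can be prescribed to meet the
complement of `t` in the least common multiple. -/
theorem exists_coreEquiv_mul {s t : S} (h : Meets s t) {m : ℕ+} (hm : m ∈ Set.range N)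
    (hs : N s = N t * m) : ∃ u, N u = m ∧ CoreEquiv s (t * u) := by
  obtain ⟨x, y, hxy⟩ := meets_iff.1 h
  obtain ⟨u, hu, hyu⟩ := hN.exists_meets y m hm
  refine ⟨u, hu, hN.coreEquiv_of_meets (by rw [map_mul, hu, hs]) ?_⟩
  have h1 : Meets (t * y) (t * u) := meets_mul_left_iff.2 hyu
  rw [← hxy] at h1
  exact h1.of_mul_left

/-- Noncore irreducible elements are those whose value is irreducible in the image of `N`. -/
theorem isNoncoreIrreducible_iff {s : S} : IsNoncoreIrreducible s ↔
    N s ≠ 1 ∧ ∀ t r : S, N s = N t * N r → N t = 1 ∨ N r = 1 := by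
  constructor
  · rintro ⟨h, h'⟩
    refine ⟨fun h1 => h (hN.eq_one_iff.1 h1), fun t r htr => ?_⟩
    obtain ⟨t', ht', hst⟩ := hN.exists_meets s (N t) ⟨t, rfl⟩
    obtain ⟨u, hu, a, ha, b, hb, hab⟩ := hN.exists_coreEquiv_mul hst (m := N r) ⟨r, rfl⟩
      (by rw [htr, ht'])
    rw [mul_assoc] at hab
    rw [← ht', ← hu, hN.eq_one_iff, hN.eq_one_iff]
    exact (h' a ha t' (u * b) hab).imp_right left_mem_core
  · rintro ⟨h, h'⟩
    refine ⟨fun h1 => h (hN.eq_one_iff.2 h1), fun a ha t r htr => ?_⟩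
    rw [← hN.eq_one_iff, ← hN.eq_one_iff]
    refine h' t r ?_
    simpa [hN.eq_one_iff.2 ha] using congrArg N htr

theorem isNoncoreIrreducible_congr {s t : S} (h : N s = N t) :
    IsNoncoreIrreducible s ↔ IsNoncoreIrreducible t := by
  rw [hN.isNoncoreIrreducible_iff, hN.isNoncoreIrreducible_iff, h]

/-- If the values of two noncore irreducible elements differ, then the value of their least common
multiple is the product: it divides the product with a cofactor in the image of `N`, and
irreducibility leaves no other possibility. -/
theorem map_eq_of_isRightLcm {s t p q : S} (hs : IsNoncoreIrreducible s)
    (ht : IsNoncoreIrreducible t) (hne : N s ≠ N t) (h : IsRightLcm s t p q) :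
    N p = N t ∧ N q = N s := by
  have hpq : N s * N p = N t * N q := by rw [← map_mul, h.1, map_mul]
  obtain ⟨u, hu, hpu⟩ := hN.exists_meets p (N t) ⟨t, rfl⟩
  have hsut : Meets (s * u) t := by
    have h1 : Meets (s * p) (s * u) := meets_mul_left_iff.2 hpu
    rw [h.1] at h1
    exact h1.of_mul_left.symm
  obtain ⟨u', -, c, hc, c', -, hcc⟩ := hN.exists_coreEquiv_mul hsut (m := N s) ⟨s, rfl⟩
    (by rw [map_mul, hu, mul_comm])
  rw [mul_assoc, mul_assoc] at hcc
  obtain ⟨z, hz, -⟩ := h.2 _ _ hcc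
  have hprod : N t = N p * N z := by
    simpa [hN.eq_one_iff.2 hc, hu] using congrArg N hz
  have hp : N p = N t := by
    rcases (hN.isNoncoreIrreducible_iff.1 ht).2 p z hprod with h1 | h1
    · rw [h1, mul_one] at hpq
      rcases (hN.isNoncoreIrreducible_iff.1 hs).2 t q hpq with h2 | h2
      · exact absurd h2 (hN.isNoncoreIrreducible_iff.1 ht).1
      · rw [h2, mul_one] at hpq
        exact absurd hpq hne
    · rw [hprod, h1, mul_one]
  rw [hp, mul_comm] at hpq
  exact ⟨hp, (mul_left_cancel hpq).symm⟩

/-- Noncore irreducible elements with different values meet. Sending `u` with `N u = N t` to an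
element of the same value that meets `s * u` is injective on core equivalence classes, hence hits
the class of `t`. -/
theorem meets_of_map_ne {s t : S} (hs : IsNoncoreIrreducible s) (ht : IsNoncoreIrreducible t)
    (hne : N s ≠ N t) : Meets s t := by
  choose g hg hgm using fun u => hN.exists_meets (s * u) (N t) ⟨t, rfl⟩
  have hinj : ∀ x ∈ N ⁻¹' {N t}, ∀ y ∈ N ⁻¹' {N t}, coreSetoid S (g x) (g y) →
      coreSetoid S x y := by
    intro x hx y hy hxy
    -- all elements `u` of value `N t` for which `s * u` meets `g x` are equivalent to `p`
    obtain ⟨p, q, hpq⟩ := (hgm x).of_mul_left.exists_isRightLcm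
    have hirr : IsNoncoreIrreducible (g x) := (hN.isNoncoreIrreducible_congr (hg x)).2 ht
    have hp := (hN.map_eq_of_isRightLcm hs hirr (by rwa [hg x]) hpq).1
    have key : ∀ w, N w = N t → Meets (s * w) (g x) → CoreEquiv w p := by
      intro w hw hm
      refine hN.coreEquiv_of_meets (by rw [hw, hp, hg x]) ?_
      obtain ⟨c, d, hcd⟩ := meets_iff.1 hm
      obtain ⟨z, hz, -⟩ := hpq.2 (w * c) d (by rw [← mul_assoc, hcd])
      exact meets_iff.2 ⟨c, z, hz⟩
    exact (key x hx (hgm x)).trans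
      (key y hy (CoreEquiv.meets_of_meets (CoreEquiv.symm hxy) (hgm y).symm).symm).symm
  obtain ⟨u, -, hu⟩ := exists_rel_of_finite_image_mk (coreSetoid S) (N ⁻¹' {N t})
    (fun x y h hx => (hN.eq_of_coreEquiv h).symm.trans hx)
    (Set.finite_of_encard_eq_coe (hN.encard_classes _ ⟨t, rfl⟩)) g (fun x _ => hg x) hinj t rfl
  exact ((CoreEquiv.meets_of_meets hu (hgm u).symm).symm).of_mul_left

theorem coreGraph_adj_iff_map_ne {s t : NoncoreIrreducible S} :
    (coreGraph S).Adj (vertex s) (vertex t) ↔ N s ≠ N t := by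
  rw [coreGraph_adj_iff]
  constructor
  · exact fun h h' => h.1 (hN.coreEquiv_of_meets h' h.2)
  · exact fun h => ⟨fun h' => h (hN.eq_of_coreEquiv h'), hN.meets_of_map_ne s.2 t.2 h⟩

/-- The coconnected components are the fibres of the scale on noncore irreducible elements. -/
theorem coIndex_eq_iff {s t : NoncoreIrreducible S} : coIndex s = coIndex t ↔ N s = N t := by
  constructor
  · intro h
    have hr := (SimpleGraph.reachable_iff_reflTransGen _ _).1
      (SimpleGraph.ConnectedComponent.exact h)
    have key : ∀ v, Relation.ReflTransGen (coreGraph S)ᶜ.Adj (vertex s) v →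
        ∀ r : NoncoreIrreducible S, vertex r = v → N s = N r := by
      intro v hv
      induction hv with
      | refl => exact fun r hr => (hN.eq_of_coreEquiv (vertex_eq_iff.1 hr)).symm
      | @tail b c _ hbc ih =>
        rintro r rfl
        obtain ⟨x, rfl⟩ := exists_vertex_eq b
        rw [ih x rfl]
        by_contra hne
        exact ((SimpleGraph.compl_adj _ _ _).1 hbc).2 (hN.coreGraph_adj_iff_map_ne.2 hne)
    exact key _ hr t rfl
  · intro h
    by_contra hne
    have hm := meets_of_coIndex_ne hne
    exact hne (coIndex_eq_of_coreEquiv (hN.coreEquiv_of_meets h hm))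

/-- The vertices of the component of `s` are the core equivalence classes in `N⁻¹(N s)`. -/
theorem encard_verts (s : NoncoreIrreducible S) :
    (coIndex s).verts.encard = ((N s : ℕ) : ℕ∞) := by
  let ι : Vertex S → Quotient (coreSetoid S) :=
    Quotient.map' Subtype.val fun _ _ h => h
  have hι : Function.Injective ι := by
    intro v w h
    obtain ⟨x, rfl⟩ := exists_vertex_eq v
    obtain ⟨y, rfl⟩ := exists_vertex_eq w
    exact vertex_eq_iff.2 (Quotient.exact h)
  rw [← hN.encard_classes (N s) ⟨s, rfl⟩, ← hι.encard_image]
  congr 1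
  refine Set.Subset.antisymm ?_ ?_
  · rintro _ ⟨v, hv, rfl⟩
    obtain ⟨x, rfl⟩ := exists_vertex_eq v
    exact ⟨x, hN.coIndex_eq_iff.1 hv, rfl⟩
  · rintro _ ⟨x, hx, rfl⟩
    exact ⟨vertex ⟨x, (hN.isNoncoreIrreducible_congr hx).2 s.2⟩, hN.coIndex_eq_iff.2 hx, rfl⟩

/-- Every value is a product of values of noncore irreducible elements, by induction on its
size. -/
theorem exists_list_map_eq (s : S) :
    ∃ l : List (NoncoreIrreducible S),
      N s = (l.map fun x : NoncoreIrreducible S => N (x : S)).prod := by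
  obtain ⟨k, hk⟩ : ∃ k : ℕ, (N s : ℕ) = k := ⟨_, rfl⟩
  induction k using Nat.strong_induction_on generalizing s with
  | _ k ih =>
    by_cases h1 : N s = 1
    · exact ⟨[], by simpa using h1⟩
    by_cases hs : IsNoncoreIrreducible s
    · exact ⟨[⟨s, hs⟩], by simp⟩
    rw [hN.isNoncoreIrreducible_iff] at hs
    push Not at hs
    obtain ⟨t, r, htr, ht, hr⟩ := hs h1
    have hmul : (N s : ℕ) = N t * N r := by rw [htr, PNat.mul_coe]
    have ht' : 1 < (N t : ℕ) := lt_of_le_of_ne (N t).2 fun h => ht (PNat.eq h.symm)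
    have hr' : 1 < (N r : ℕ) := lt_of_le_of_ne (N r).2 fun h => hr (PNat.eq h.symm)
    obtain ⟨l, hl⟩ := ih _ (by rw [← hk, hmul]; nlinarith) t rfl
    obtain ⟨l', hl'⟩ := ih _ (by rw [← hk, hmul]; nlinarith) r rfl
    exact ⟨l ++ l', by rw [htr, hl, hl', List.map_append, List.prod_append]⟩

omit hN in
theorem prod_map_mem_range (l : List (NoncoreIrreducible S)) :
    (l.map fun x : NoncoreIrreducible S => N (x : S)).prod ∈ Set.range N :=
  ⟨(l.map Subtype.val).prod, by rw [map_list_prod, List.map_map]; rfl⟩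

/-- A factorization of the value `N s` lifts to a factorization of `s`. -/
theorem exists_list_coreEquiv (l : List (NoncoreIrreducible S)) (s : S)
    (h : N s = (l.map fun x : NoncoreIrreducible S => N (x : S)).prod) :
    ∃ l' : List (NoncoreIrreducible S), CoreEquiv s (l'.map Subtype.val).prod := by
  induction l generalizing s with
  | nil => exact ⟨[], coreEquiv_of_mem_core (hN.eq_one_iff.1 (by simpa using h)) one_mem_core⟩
  | cons x l ih =>
    obtain ⟨t, ht, hst⟩ := hN.exists_meets s (N x) ⟨x, rfl⟩
    obtain ⟨u, hu, hsu⟩ := hN.exists_coreEquiv_mul hst (prod_map_mem_range l)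
      (by rw [h, ht, List.map_cons, List.prod_cons])
    obtain ⟨l', hl'⟩ := ih u hu
    exact ⟨⟨t, (hN.isNoncoreIrreducible_congr ht).2 x.2⟩ :: l', hsu.trans (hl'.mul_left t)⟩

theorem noncoreFactorable : NoncoreFactorable S := fun s _ => by
  obtain ⟨l, hl⟩ := hN.exists_list_map_eq s
  exact hN.exists_list_coreEquiv l s hl

theorem edgeFreeCoComponents : EdgeFreeCoComponents S := by
  rintro i v hv w hw h
  obtain ⟨x, rfl⟩ := exists_vertex_eq v
  obtain ⟨y, rfl⟩ := exists_vertex_eq w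
  rw [mem_verts_iff] at hv hw
  exact hN.coreGraph_adj_iff_map_ne.1 h (hN.coIndex_eq_iff.1 (hv.trans hw.symm))

theorem balancedFactorization : BalancedFactorization S := by
  intro s t hst
  have hne : N s ≠ N t := fun h => hst (hN.coIndex_eq_iff.2 h)
  obtain ⟨p, q, h⟩ := (hN.meets_of_map_ne s.2 t.2 hne).exists_isRightLcm
  obtain ⟨hp, hq⟩ := hN.map_eq_of_isRightLcm s.2 t.2 hne h
  obtain ⟨h1, h2⟩ := isRightLcm_iff.1 h
  exact ⟨⟨q, (hN.isNoncoreIrreducible_congr hq).2 s.2⟩,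
    ⟨p, (hN.isNoncoreIrreducible_congr hp).2 t.2⟩, h1, h2,
    hN.coIndex_eq_iff.2 hq, hN.coIndex_eq_iff.2 hp⟩

/-- Irreducible values are prime in the image of the scale. -/
theorem exists_map_eq_mul {x y a b : S} (hx : IsNoncoreIrreducible x)
    (hy : IsNoncoreIrreducible y) (hne : N x ≠ N y) (h : N x * N a = N y * N b) :
    ∃ c, N b = N x * N c := by
  obtain ⟨t, ht, hxt⟩ := hN.exists_meets (x * a) (N y) ⟨y, rfl⟩
  have htirr : IsNoncoreIrreducible t := (hN.isNoncoreIrreducible_congr ht).2 hy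
  obtain ⟨u, hu, c, hc, d, hd, hcd⟩ := hN.exists_coreEquiv_mul hxt (m := N b) ⟨b, rfl⟩
    (by rw [map_mul, h, ht])
  obtain ⟨p, q, hpq⟩ := hxt.of_mul_left.exists_isRightLcm
  have hq := (hN.map_eq_of_isRightLcm hx htirr (by rwa [ht]) hpq).2
  obtain ⟨z, -, hz⟩ := hpq.2 (a * c) (u * d) (by rw [← mul_assoc, hcd, mul_assoc])
  refine ⟨z, ?_⟩
  simpa [hN.eq_one_iff.2 hd, hu, hq] using congrArg N hz

/-- Components are represented by their common value, which is irreducible and prime in the image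
of the scale; unique factorization follows as for natural numbers. -/
theorem freelyGenerates : FreelyGenerates S := by
  choose rep hrep using fun i : CoComponent S => exists_coIndex_eq i
  have hrepN (s : NoncoreIrreducible S) : N (rep (coIndex s)) = N s :=
    hN.coIndex_eq_iff.1 (hrep _)
  have hne1 (i) : N (rep i) ≠ 1 := (hN.isNoncoreIrreducible_iff.1 (rep i).2).1
  have hrange (m : Multiset (CoComponent S)) :
      ∃ a, N a = (m.map fun i => N (rep i)).prod := by
    induction m using Multiset.induction with
    | empty => exact ⟨1, by simp⟩
    | cons i m ih =>
      obtain ⟨a, ha⟩ := ih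
      exact ⟨rep i * a, by simp [ha]⟩
  have hmem (m : Multiset (CoComponent S)) : ∀ i a,
      N (rep i) * N a = (m.map fun i => N (rep i)).prod → i ∈ m := by
    induction m using Multiset.induction with
    | empty =>
      intro i a h
      exact absurd ((PNat.dvd_one_iff _).1 (Dvd.intro _ (by simpa using h))) (hne1 i)
    | cons j m ih =>
      intro i a h
      by_cases hij : i = j
      · exact hij ▸ Multiset.mem_cons_self _ _
      obtain ⟨b, hb⟩ := hrange m
      rw [Multiset.map_cons, Multiset.prod_cons, ← hb] at h
      have hne : N (rep i) ≠ N (rep j) := fun h' =>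
        hij ((hrep i).symm.trans ((hN.coIndex_eq_iff.2 h').trans (hrep j)))
      obtain ⟨c, hc⟩ := hN.exists_map_eq_mul (rep i).2 (rep j).2 hne h
      exact Multiset.mem_cons_of_mem (ih i c (by rw [← hc, hb]))
  refine ⟨fun i => N (rep i), fun i => ?_, fun m => ?_, fun hbot => ?_⟩
  · rw [← hN.encard_verts, hrep]
  · induction m using Multiset.induction with
    | empty =>
      intro m' h
      by_contra hm'
      obtain ⟨i, hi⟩ := Multiset.exists_mem_of_ne_zero (Ne.symm hm')
      obtain ⟨m'', rfl⟩ := Multiset.exists_cons_of_mem hi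
      simp only [Multiset.map_zero, Multiset.prod_zero, Multiset.map_cons,
        Multiset.prod_cons] at h
      exact hne1 i ((PNat.dvd_one_iff _).1 (Dvd.intro _ h.symm))
    | cons i m ih =>
      intro m' h
      simp only [Multiset.map_cons, Multiset.prod_cons] at h ih
      obtain ⟨a, ha⟩ := hrange m
      obtain ⟨m'', rfl⟩ := Multiset.exists_cons_of_mem (hmem m' i a (by rw [ha, h]))
      rw [Multiset.map_cons, Multiset.prod_cons] at h
      rw [ih (mul_left_cancel h)]
  · obtain ⟨s, hs⟩ := hN.nontrivial
    obtain ⟨l, hl⟩ := hN.exists_list_map_eq s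
    rcases l with _ | ⟨x, l⟩
    · exact hs (by simpa using hl)
    · have hx : N (rep (coIndex x)) ∈ Submonoid.closure (Set.range fun i => N (rep i)) :=
        Submonoid.subset_closure ⟨_, rfl⟩
      rw [hbot, Submonoid.mem_bot] at hx
      exact hne1 _ hx

end IsGeneralizedScale

end Scale

/-! ### Types of elements -/

section Types

variable {S : Type*} [RightLCMMonoid S]

theorem coreEquiv_of_coIndex_eq (hE : EdgeFreeCoComponents S) {s t : NoncoreIrreducible S}
    (h : coIndex s = coIndex t) (hm : Meets (s : S) (t : S)) : CoreEquiv (s : S) (t : S) := by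
  by_contra hst
  exact hE (coIndex t) (vertex s) h (vertex t) rfl (coreGraph_adj_iff.2 ⟨hst, hm⟩)

theorem coreEquiv_coreMul_iff {a : S} (ha : a ∈ core S) {s t : NoncoreIrreducible S} :
    CoreEquiv (coreMul ha s : S) (coreMul ha t : S) ↔ CoreEquiv (s : S) (t : S) :=
  ⟨CoreEquiv.of_mul_left, CoreEquiv.mul_left a⟩

theorem exists_coreEquiv_coreMul {a : S} (ha : a ∈ core S) (t : NoncoreIrreducible S) :
    ∃ s, CoreEquiv (coreMul ha s : S) (t : S) := by
  obtain ⟨p, q, hpq, hq⟩ := exists_isRightLcm_of_mem_core ha (t : S)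
  have h : CoreEquiv (a * p) (t : S) := hpq.1 ▸ coreEquiv_mul_core _ hq
  exact ⟨⟨p, (isNoncoreIrreducible_core_mul_iff ha).1 (t.2.of_coreEquiv h.symm)⟩, h⟩

/-- Left translation by a core element is an automorphism of the core graph, so it permutes the
coconnected components. It fixes each of them because different components have different
cardinalities. -/
theorem coIndex_coreMul (hF : FreelyGenerates S) (hE : EdgeFreeCoComponents S) {a : S}
    (ha : a ∈ core S) (s : NoncoreIrreducible S) : coIndex (coreMul ha s) = coIndex s := by
  have hiff (x y : NoncoreIrreducible S) :
      coIndex (coreMul ha x) = coIndex (coreMul ha y) ↔ coIndex x = coIndex y := by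
    constructor
    · intro h
      by_contra hne
      have hm := meets_of_coIndex_ne hne
      have := coreEquiv_of_coIndex_eq hE h (meets_mul_left_iff.2 hm)
      exact hne (coIndex_eq_of_coreEquiv ((coreEquiv_coreMul_iff ha).1 this))
    · intro h
      by_contra hne
      have hm := meets_mul_left_iff.1 (meets_of_coIndex_ne hne)
      exact hne (coIndex_eq_of_coreEquiv
        ((coreEquiv_coreMul_iff ha).2 (coreEquiv_of_coIndex_eq hE h hm)))
  let f : Vertex S → Vertex S :=
    Quotient.map (coreMul ha) fun _ _ h => (coreEquiv_coreMul_iff ha).2 h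
  have hf : Function.Injective f := by
    intro v w h
    obtain ⟨x, rfl⟩ := exists_vertex_eq v
    obtain ⟨y, rfl⟩ := exists_vertex_eq w
    exact vertex_eq_iff.2 ((coreEquiv_coreMul_iff ha).1 (Quotient.exact h))
  have himg : f '' (coIndex s).verts = (coIndex (coreMul ha s)).verts := by
    refine Set.Subset.antisymm ?_ ?_
    · rintro _ ⟨v, hv, rfl⟩
      obtain ⟨x, rfl⟩ := exists_vertex_eq v
      exact (hiff x s).2 hv
    · intro w hw
      obtain ⟨y, rfl⟩ := exists_vertex_eq w
      obtain ⟨x, hx⟩ := exists_coreEquiv_coreMul ha y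
      refine ⟨vertex x, (hiff x s).1 ((coIndex_eq_of_coreEquiv hx).trans hw), ?_⟩
      exact vertex_eq_iff.2 hx
  obtain ⟨n, hn, hinj, -⟩ := hF
  have hcard := hf.encard_image (coIndex s).verts
  rw [himg, hn, hn] at hcard
  have hn' : n (coIndex (coreMul ha s)) = n (coIndex s) := PNat.eq (by exact_mod_cast hcard)
  simpa using @hinj {coIndex (coreMul ha s)} {coIndex s} (by simpa using hn')

/-- `HasType s m`: up to core equivalence, `s` is a product of noncore irreducible elements whose
coconnected components, counted with multiplicity, form `m`. -/
inductive HasType : S → Multiset (CoComponent S) → Prop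
  | of_mem_core {s : S} : s ∈ core S → HasType s 0
  | cons {s y : S} {m : Multiset (CoComponent S)} (x : NoncoreIrreducible S) :
      CoreEquiv s (x * y) → HasType y m → HasType s (coIndex x ::ₘ m)

namespace HasType

theorem of_coreEquiv {s t : S} {m : Multiset (CoComponent S)} (h : HasType s m)
    (hst : CoreEquiv s t) : HasType t m := by
  cases h with
  | of_mem_core h => exact of_mem_core (hst.mem_core h)
  | cons x hx hy => exact cons x (hst.symm.trans hx) hy

theorem eq_zero_of_mem_core {s : S} {m : Multiset (CoComponent S)} (h : HasType s m)
    (hs : s ∈ core S) : m = 0 := by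
  cases h with
  | of_mem_core h => rfl
  | cons x hx hy => exact absurd (left_mem_core (hx.mem_core hs)) x.2.1

theorem mem_core_of_eq_zero {m : Multiset (CoComponent S)} {s : S} (h : HasType s m) (hm : m = 0) :
    s ∈ core S := by
  cases h with
  | of_mem_core h => exact h
  | cons x hx hy => simp at hm

theorem coIndex (x : NoncoreIrreducible S) : HasType (x : S) {RightLCM.coIndex x} :=
  cons x (by simpa using CoreEquiv.refl (x : S)) (of_mem_core one_mem_core)

theorem list_prod (l : List (NoncoreIrreducible S)) :
    ∃ m, HasType (l.map Subtype.val).prod m := by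
  induction l with
  | nil => exact ⟨0, of_mem_core one_mem_core⟩
  | cons x l ih =>
    obtain ⟨m, hm⟩ := ih
    exact ⟨_, cons x (by simpa using CoreEquiv.refl _) hm⟩

end HasType

theorem exists_hasType (hfac : NoncoreFactorable S) (s : S) : ∃ m, HasType s m := by
  by_cases hs : s ∈ core S
  · exact ⟨0, .of_mem_core hs⟩
  · obtain ⟨l, hl⟩ := hfac s hs
    obtain ⟨m, hm⟩ := HasType.list_prod l
    exact ⟨m, hm.of_coreEquiv hl.symm⟩

namespace HasType

variable (hF : FreelyGenerates S) (hE : EdgeFreeCoComponents S)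
include hF hE

theorem core_mul {a s : S} {m : Multiset (CoComponent S)} (h : HasType s m) (ha : a ∈ core S) :
    HasType (a * s) m := by
  cases h with
  | of_mem_core h => exact of_mem_core (mul_mem_core ha h)
  | cons x hx hy =>
    rw [← coIndex_coreMul hF hE ha x]
    refine cons (coreMul ha x) ?_ hy
    simpa [coreMul, mul_assoc] using hx.mul_left a

/-- Left division by a core element preserves types. -/
theorem of_core_mul {u : S} {m : Multiset (CoComponent S)} (h : HasType u m) :
    ∀ a ∈ core S, ∀ v, CoreEquiv u (a * v) → HasType v m := by
  induction h with
  | of_mem_core h => exact fun a _ v hv => of_mem_core (right_mem_core (hv.mem_core h))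
  | @cons s y m x hx hy ih =>
    intro a ha v hv
    obtain ⟨c, hc, d, hd, hcd⟩ := hv.symm.trans hx
    obtain ⟨p, q, hpq, hq⟩ := exists_isRightLcm_of_mem_core ha (x : S)
    obtain ⟨z, hz, hz'⟩ := hpq.2 (v * c) (y * d) (by rw [← mul_assoc, hcd, mul_assoc])
    have hxa : CoreEquiv (a * p) (x : S) := hpq.1 ▸ coreEquiv_mul_core _ hq
    have hp := (isNoncoreIrreducible_core_mul_iff ha).1 (x.2.of_coreEquiv hxa.symm)
    have hpi : RightLCM.coIndex ⟨p, hp⟩ = RightLCM.coIndex x := by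
      rw [← coIndex_coreMul hF hE ha]
      exact coIndex_eq_of_coreEquiv hxa
    rw [← hpi]
    refine cons ⟨p, hp⟩ ?_ (ih q hq z ?_)
    · exact hz ▸ (coreEquiv_mul_core v hc).symm
    · exact hz' ▸ (coreEquiv_mul_core y hd).symm

theorem core_mul_iff {a s : S} {m : Multiset (CoComponent S)} (ha : a ∈ core S) :
    HasType (a * s) m ↔ HasType s m :=
  ⟨fun h => h.of_core_mul hF hE a ha s (CoreEquiv.refl _), fun h => h.core_mul hF hE ha⟩

/-- Core equivalence is not compatible with right multiplication, but it is so up to a change of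
the right factor that preserves types. -/
theorem exists_coreEquiv_mul {s t : S} (h : CoreEquiv s t) (y : S) :
    ∃ y', CoreEquiv (s * y) (t * y') ∧ ∀ m, HasType y m → HasType y' m := by
  obtain ⟨a, ha, b, hb, hab⟩ := h
  obtain ⟨z, a', hz, ha'⟩ := exists_isRightLcm_of_mem_core ha y
  refine ⟨b * z, ?_, fun m hy => ?_⟩
  · rw [← mul_assoc, ← hab, mul_assoc, hz.1, ← mul_assoc]
    exact (coreEquiv_mul_core _ ha').symm
  · rw [core_mul_iff hF hE hb, ← core_mul_iff hF hE ha, hz.1]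
    exact hy.of_coreEquiv (coreEquiv_mul_core _ ha').symm

variable (hB : BalancedFactorization S)
include hB

/-- The exchange argument: a noncore irreducible left divisor accounts for a member of the type. -/
theorem exists_eq_cons {s : S} {m : Multiset (CoComponent S)} (h : HasType s m) :
    ∀ (t : NoncoreIrreducible S) (y : S), CoreEquiv s (t * y) →
      ∃ m', m = RightLCM.coIndex t ::ₘ m' ∧ HasType y m' := by
  induction h with
  | of_mem_core h => exact fun t y ht => absurd (left_mem_core (ht.mem_core h)) t.2.1
  | @cons s w m x hx hw ih =>
    intro t y ht
    obtain ⟨c, hc, d, hd, hcd⟩ := hx.symm.trans ht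
    rw [mul_assoc, mul_assoc] at hcd
    by_cases hxt : RightLCM.coIndex x = RightLCM.coIndex t
    · have hequiv := coreEquiv_of_coIndex_eq hE hxt (meets_iff.2 ⟨_, _, hcd⟩)
      obtain ⟨p, q, hpq⟩ := hequiv.meets.exists_isRightLcm
      obtain ⟨hp, hq⟩ := hpq.mem_core_of_coreEquiv hequiv
      obtain ⟨z, hz, hz'⟩ := hpq.2 _ _ hcd
      refine ⟨m, by rw [hxt], ?_⟩
      have h1 : HasType (p * z) m := hz ▸ hw.of_coreEquiv (coreEquiv_mul_core w hc).symm
      have h2 : HasType (q * z) m := ((core_mul_iff hF hE hp).1 h1).core_mul hF hE hq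
      exact (hz' ▸ h2 : HasType (y * d) m).of_coreEquiv (coreEquiv_mul_core y hd)
    · obtain ⟨x', t', hI, hxt', hx', ht'⟩ := hB x t hxt
      obtain ⟨z, hz, hz'⟩ := (isRightLcm_iff.2 ⟨hI, hxt'⟩).2 _ _ hcd
      obtain ⟨m', rfl, hm'⟩ := ih t' z (hz ▸ (coreEquiv_mul_core w hc).symm)
      refine ⟨RightLCM.coIndex x ::ₘ m', by rw [ht', Multiset.cons_swap], ?_⟩
      rw [← hx']
      exact cons x' (hz' ▸ (coreEquiv_mul_core y hd).symm) hm'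

/-- The type of an element is unique: cancel the factors of one factorization from the other. -/
theorem unique {s : S} {m m' : Multiset (CoComponent S)} (h : HasType s m) (h' : HasType s m') :
    m = m' := by
  induction h generalizing m' with
  | of_mem_core h => exact (h'.eq_zero_of_mem_core h).symm
  | cons x hx hy ih =>
    obtain ⟨m'', rfl, hm''⟩ := h'.exists_eq_cons hF hE hB x _ hx
    rw [ih hm'']

omit hB in
/-- Types are additive: a factor `t` can be pushed past the core elements that relate `s` to a
product of irreducibles without changing its type. -/
theorem mul {s t : S} {m m' : Multiset (CoComponent S)} (h : HasType s m) (h' : HasType t m') :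
    HasType (s * t) (m + m') := by
  induction h generalizing t with
  | of_mem_core h => simpa using h'.core_mul hF hE h
  | cons x hx hy ih =>
    obtain ⟨t', ht', hm'⟩ := exists_coreEquiv_mul hF hE hx t
    rw [Multiset.cons_add]
    exact cons x (by simpa [mul_assoc] using ht') (ih (hm' _ h'))

/-- Noncore irreducible elements of different components can be exchanged: for fixed `x`, the
map `t ↦ t'` with `xS ∩ tS = xt'S` is injective on the finite component of `t`, hence
surjective. -/
theorem exists_exchange {x t : NoncoreIrreducible S}
    (hxt : RightLCM.coIndex x ≠ RightLCM.coIndex t) :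
    ∃ t' x' : NoncoreIrreducible S, RightLCM.coIndex t' = RightLCM.coIndex t ∧
      RightLCM.coIndex x' = RightLCM.coIndex x ∧ CoreEquiv (x * t : S) (t' * x') := by
  classical
  choose x' t' hI heq hx' ht' using hB x
  obtain ⟨n, hn, -⟩ := hF
  let g : NoncoreIrreducible S → NoncoreIrreducible S :=
    fun u => if h : RightLCM.coIndex x ≠ RightLCM.coIndex u then t' u h else u
  have hfin : (Quotient.mk (irreducibleSetoid S) ''
      {u | RightLCM.coIndex u = RightLCM.coIndex t}).Finite := by
    refine (Set.finite_of_encard_eq_coe (hn (RightLCM.coIndex t))).subset ?_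
    rintro _ ⟨u, hu, rfl⟩
    exact hu
  have hne {u} (hu : RightLCM.coIndex u = RightLCM.coIndex t) :
      RightLCM.coIndex x ≠ RightLCM.coIndex u := hu ▸ hxt
  have hg {u} (hu : RightLCM.coIndex u = RightLCM.coIndex t) : g u = t' u (hne hu) :=
    dif_pos (hne hu)
  obtain ⟨u, hu, hut⟩ := exists_rel_of_finite_image_mk (irreducibleSetoid S)
    {u | RightLCM.coIndex u = RightLCM.coIndex t}
    (fun _ _ h hx => (coIndex_eq_of_coreEquiv h).symm.trans hx) hfin g
    (fun u hu => by rw [hg hu]; exact (ht' u _).trans hu)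
    (fun u hu v hv huv => by
      rw [hg hu, hg hv] at huv
      refine coreEquiv_of_coIndex_eq hE (Eq.trans hu (Eq.symm hv)) ?_
      have hm : Meets (x * t' u (hne hu) : S) (x * t' v (hne hv) : S) :=
        meets_mul_left_iff.2 (CoreEquiv.meets huv)
      rw [heq, heq] at hm
      exact hm.of_mul_left.symm.of_mul_left.symm)
    t rfl
  rw [hg hu] at hut
  refine ⟨u, x' u (hne hu), hu, hx' u _, ?_⟩
  rw [← heq]
  exact CoreEquiv.mul_left _ (CoreEquiv.symm hut)

/-- Every member of the type can be brought to the front of a factorization. -/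
theorem exists_of_mem {s : S} {m : Multiset (CoComponent S)} (h : HasType s m)
    {i : CoComponent S} (hi : i ∈ m) : ∃ (t : NoncoreIrreducible S) (y : S),
      RightLCM.coIndex t = i ∧ CoreEquiv s (t * y) := by
  induction h with
  | of_mem_core h => simp at hi
  | @cons s w m x hx hw ih =>
    by_cases hxi : RightLCM.coIndex x = i
    · exact ⟨x, w, hxi, hx⟩
    obtain ⟨t, y, rfl, hty⟩ := ih ((Multiset.mem_cons.1 hi).resolve_left (Ne.symm hxi))
    obtain ⟨t', x', ht', -, hxt⟩ := exists_exchange hF hE hB hxi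
    obtain ⟨y', hy', -⟩ := exists_coreEquiv_mul hF hE hxt y
    refine ⟨t', x' * y', ht', ?_⟩
    have h1 := hx.trans (hty.mul_left (x : S))
    rw [← mul_assoc] at h1
    simpa [mul_assoc] using h1.trans hy'

/-- A factor in any component that occurs in the type can be split off on the left, and the
remaining factor has the remaining type. -/
theorem exists_of_cons {s : S} {i : CoComponent S} {m : Multiset (CoComponent S)}
    (h : HasType s (i ::ₘ m)) : ∃ (t : NoncoreIrreducible S) (y : S),
      RightLCM.coIndex t = i ∧ CoreEquiv s (t * y) ∧ HasType y m := by
  obtain ⟨t, y, rfl, hty⟩ := h.exists_of_mem hF hE hB (Multiset.mem_cons_self i m)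
  obtain ⟨m', hm', hy⟩ := h.exists_eq_cons hF hE hB t y hty
  rw [Multiset.cons_inj_right] at hm'
  exact ⟨t, y, rfl, hty, hm' ▸ hy⟩

/-- Elements of the same type are core equivalent or orthogonal. -/
theorem coreEquiv_of_meets {m : Multiset (CoComponent S)} : ∀ {s t : S}, HasType s m →
    HasType t m → Meets s t → CoreEquiv s t := by
  induction m using Multiset.induction with
  | empty =>
    exact fun hs ht _ =>
      coreEquiv_of_mem_core (hs.mem_core_of_eq_zero rfl) (ht.mem_core_of_eq_zero rfl)
  | cons i m ih =>
    intro s t hs ht hst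
    obtain ⟨x, y, hx, hxy, hy⟩ := hs.exists_of_cons hF hE hB
    obtain ⟨x', y', hx', hxy', hy'⟩ := ht.exists_of_cons hF hE hB
    have hm : Meets (x * y : S) (x' * y' : S) :=
      (hxy'.meets_of_meets (hxy.meets_of_meets hst).symm).symm
    have hxx := coreEquiv_of_coIndex_eq hE (hx.trans hx'.symm)
      hm.of_mul_left.symm.of_mul_left.symm
    obtain ⟨z, hz, hz'⟩ := exists_coreEquiv_mul hF hE hxx y
    have hm' : Meets z y' := meets_mul_left_iff.1 (hz.meets_of_meets hm)
    exact hxy.trans (hz.trans (((ih (hz' _ hy) hy' hm').mul_left _).trans hxy'.symm))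

/-- For given `s` there is an element of each type that meets `s`: bring a factor of that type to
the front of a product `s * t`. -/
theorem exists_meets (m : Multiset (CoComponent S)) : ∀ (s : S) (m' : Multiset (CoComponent S)),
    HasType s m' → ∃ t, HasType t m ∧ Meets s t := by
  induction m using Multiset.induction with
  | empty => exact fun s _ _ => ⟨1, of_mem_core one_mem_core, (one_mem_core s).symm⟩
  | cons i m ih =>
    intro s m' hs
    obtain ⟨t, rfl⟩ := exists_coIndex_eq i
    have hst := hs.mul hF hE (HasType.coIndex t)
    rw [add_comm, Multiset.singleton_add] at hst
    obtain ⟨x, y, hx, hxy, hy⟩ := hst.exists_of_cons hF hE hB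
    obtain ⟨u, hu, hyu⟩ := ih y m' hy
    refine ⟨x * u, hx ▸ cons x (CoreEquiv.refl _) hu, ?_⟩
    exact (hxy.symm.meets_of_meets (meets_mul_left_iff.2 hyu)).of_mul_left

/-- The number of classes of a given type is the product of the cardinalities of the components
in the type: `([x], [y]) ↦ [xy]`, formed with fixed representatives, is a bijection. -/
theorem encard_classes {n : CoComponent S → ℕ+}
    (hn : ∀ i : CoComponent S, i.verts.encard = ((n i : ℕ) : ℕ∞))
    (m : Multiset (CoComponent S)) :
    (Quotient.mk (coreSetoid S) '' {s | HasType s m}).encard =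
      (((m.map n).prod : ℕ+) : ℕ) := by
  induction m using Multiset.induction with
  | empty =>
    have : Quotient.mk (coreSetoid S) '' {s | HasType s 0} = {Quotient.mk (coreSetoid S) 1} := by
      refine Set.Subset.antisymm ?_ ?_
      · rintro _ ⟨s, hs, rfl⟩
        exact Quotient.sound (coreEquiv_of_mem_core (hs.mem_core_of_eq_zero rfl) one_mem_core)
      · rintro _ rfl
        exact ⟨1, of_mem_core one_mem_core, rfl⟩
    simp [this]
  | cons i m ih =>
    choose rep hrep using fun v : Vertex S => exists_vertex_eq v
    have hout {q : Quotient (coreSetoid S)}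
        (hq : q ∈ Quotient.mk (coreSetoid S) '' {s | HasType s m}) : HasType q.out m := by
      obtain ⟨s, hs, rfl⟩ := hq
      exact HasType.of_coreEquiv hs (CoreEquiv.symm (Quotient.mk_out (s := coreSetoid S) s))
    let φ : Vertex S × Quotient (coreSetoid S) → Quotient (coreSetoid S) :=
      fun p => Quotient.mk _ ((rep p.1 : S) * p.2.out)
    have hinj : Set.InjOn φ (i.verts ×ˢ (Quotient.mk (coreSetoid S) '' {s | HasType s m})) := by
      rintro ⟨v, q⟩ ⟨hv, hq⟩ ⟨w, r⟩ ⟨hw, hr⟩ h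
      have h' : CoreEquiv ((rep v : S) * q.out) ((rep w : S) * r.out) := Quotient.exact h
      simp only at hv hw
      rw [← hrep v, mem_verts_iff] at hv
      rw [← hrep w, mem_verts_iff] at hw
      have hvw : v = w := by
        rw [← hrep v, ← hrep w, vertex_eq_iff]
        exact coreEquiv_of_coIndex_eq hE (hv.trans hw.symm)
          h'.meets.of_mul_left.symm.of_mul_left.symm
      subst hvw
      have hqr := Quotient.sound (s := coreSetoid S) h'.of_mul_left
      rw [Quotient.out_eq, Quotient.out_eq] at hqr
      rw [hqr]
    have himg : φ '' (i.verts ×ˢ (Quotient.mk (coreSetoid S) '' {s | HasType s m})) =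
        Quotient.mk (coreSetoid S) '' {s | HasType s (i ::ₘ m)} := by
      refine Set.Subset.antisymm ?_ ?_
      · rintro _ ⟨⟨v, q⟩, ⟨hv, hq⟩, rfl⟩
        simp only at hv
        rw [← hrep v, mem_verts_iff] at hv
        exact ⟨_, hv ▸ cons (rep v) (CoreEquiv.refl _) (hout hq), rfl⟩
      · rintro _ ⟨s, hs, rfl⟩
        obtain ⟨x, y, hx, hxy, hy⟩ := HasType.exists_of_cons hF hE hB hs
        have hxr : CoreEquiv (x : S) (rep (vertex x) : S) :=
          vertex_eq_iff.1 (hrep (vertex x)).symm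
        obtain ⟨z, hz, hz'⟩ := exists_coreEquiv_mul hF hE hxr y
        refine ⟨⟨vertex x, Quotient.mk _ z⟩, ⟨mem_verts_iff.2 hx, z, hz' _ hy, rfl⟩, ?_⟩
        refine Quotient.sound ?_
        exact ((CoreEquiv.mul_left _ (Quotient.mk_out (s := coreSetoid S) z)).trans
          hz.symm).trans hxy.symm
    rw [← himg, hinj.encard_image, Set.encard_prod, ih, hn, Multiset.map_cons, Multiset.prod_cons,
      PNat.mul_coe, Nat.cast_mul]

end HasType

end Types

/-! ### Construction and uniqueness of the scale -/

section Construction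

variable {S : Type*} [RightLCMMonoid S]

/-- The scale sends an element to the product of the cardinalities of the components in its
type. -/
theorem exists_isGeneralizedScale (hF : FreelyGenerates S) (hE : EdgeFreeCoComponents S)
    (hfac : NoncoreFactorable S) (hB : BalancedFactorization S) :
    ∃ N : S →* ℕ+, IsGeneralizedScale S N ∧ ∀ s : NoncoreIrreducible S,
      ((N s : ℕ) : ℕ∞) = (coIndex s).verts.encard := by
  choose τ hτ using exists_hasType hfac
  have huniq {s m} (h : HasType s m) : τ s = m := (hτ s).unique hF hE hB h
  obtain ⟨n, hn, hinj, hnt⟩ := id hF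
  let N : S →* ℕ+ :=
    { toFun := fun s => ((τ s).map n).prod
      map_one' := by simp [huniq (.of_mem_core one_mem_core)]
      map_mul' := fun s t => by
        simp only [huniq ((hτ s).mul hF hE (hτ t)), Multiset.map_add, Multiset.prod_add] }
  have hNτ (s) : N s = ((τ s).map n).prod := rfl
  have hτ_eq {s t} (h : N s = N t) : τ s = τ t := hinj h
  have hNirr (s : NoncoreIrreducible S) : N s = n (coIndex s) := by
    simp [hNτ, huniq (HasType.coIndex s)]
  refine ⟨N, ⟨?_, ?_, ?_, ?_⟩, fun s => by rw [hNirr, hn]⟩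
  · by_contra hall
    push Not at hall
    refine hnt (le_bot_iff.1 (Submonoid.closure_le.2 ?_))
    rintro _ ⟨i, rfl⟩
    obtain ⟨s, rfl⟩ := exists_coIndex_eq i
    exact (hNirr s).symm.trans (hall s)
  · rintro _ ⟨s, rfl⟩
    have : (N ⁻¹' {N s} : Set S) = {t | HasType t (τ s)} := by
      ext t
      refine ⟨fun h => ?_, fun h => ?_⟩
      · have := hτ t
        rwa [hτ_eq h] at this
      · simp [hNτ, huniq h]
    rw [this, HasType.encard_classes hF hE hB hn, hNτ]
  · intro s t h
    by_cases hm : Meets s t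
    · exact .inl (HasType.coreEquiv_of_meets hF hE hB (hτ s) (hτ_eq h ▸ hτ t) hm)
    · exact .inr hm
  · rintro s _ ⟨r, rfl⟩
    obtain ⟨t, ht, hst⟩ := HasType.exists_meets hF hE hB (τ r) s (τ s) (hτ s)
    exact ⟨t, by rw [hNτ, hNτ, huniq ht], hst⟩

/-- A homomorphism with the prescribed values on noncore irreducible elements is trivial on the
core, because left translation by a core element preserves these values, and is therefore
determined by factorizations. -/
theorem monoidHom_eq_of_map_eq_encard (hF : FreelyGenerates S) (hE : EdgeFreeCoComponents S)
    (hfac : NoncoreFactorable S) {M N : S →* ℕ+}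
    (hM : ∀ s : NoncoreIrreducible S, ((M s : ℕ) : ℕ∞) = (coIndex s).verts.encard)
    (hN : ∀ s : NoncoreIrreducible S, ((N s : ℕ) : ℕ∞) = (coIndex s).verts.encard) : M = N := by
  obtain ⟨x⟩ : Nonempty (NoncoreIrreducible S) := by
    by_contra hempty
    obtain ⟨n, -, -, hnt⟩ := hF
    refine hnt (le_bot_iff.1 (Submonoid.closure_le.2 ?_))
    rintro _ ⟨i, rfl⟩
    exact absurd ⟨(exists_coIndex_eq i).choose⟩ hempty
  have hone {K : S →* ℕ+}
      (hK : ∀ s : NoncoreIrreducible S, ((K s : ℕ) : ℕ∞) = (coIndex s).verts.encard)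
      {a : S} (ha : a ∈ core S) : K a = 1 := by
    have h : ((K (a * x) : ℕ) : ℕ∞) = ((K x : ℕ) : ℕ∞) := by
      rw [hK x, ← coIndex_coreMul hF hE ha x]
      exact hK (coreMul ha x)
    have h' : K (a * x) = K x := PNat.eq (by exact_mod_cast h)
    simpa using h'
  have hMN (s : NoncoreIrreducible S) : M s = N s :=
    PNat.eq (by exact_mod_cast (hM s).trans (hN s).symm)
  ext1 s
  by_cases hs : s ∈ core S
  · rw [hone hM hs, hone hN hs]
  obtain ⟨l, a, ha, b, hb, hab⟩ := hfac s hs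
  have h1 := congrArg M hab
  have h2 := congrArg N hab
  simp only [map_mul, hone hM ha, hone hM hb, hone hN ha, hone hN hb, mul_one, map_list_prod,
    List.map_map] at h1 h2
  rw [h1, h2]
  exact congrArg List.prod (List.map_congr_left fun x _ => hMN x)

end Construction

end RightLCM

theorem mainTheorem2 (S : Type*) [RightLCMMonoid S] :
    ((∃ N : S →* ℕ+, RightLCM.IsGeneralizedScale S N) ↔
      (RightLCM.FreelyGenerates S ∧ RightLCM.EdgeFreeCoComponents S ∧
        RightLCM.NoncoreFactorable S ∧ RightLCM.BalancedFactorization S)) ∧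
    ((RightLCM.FreelyGenerates S ∧ RightLCM.EdgeFreeCoComponents S ∧
        RightLCM.NoncoreFactorable S ∧ RightLCM.BalancedFactorization S) →
      ∃ N : S →* ℕ+, RightLCM.IsGeneralizedScale S N ∧
        (∀ s : RightLCM.NoncoreIrreducible S,
          ((N s : ℕ) : ℕ∞) = (RightLCM.coIndex s).verts.encard) ∧
        (∀ M : S →* ℕ+, RightLCM.IsGeneralizedScale S M → M = N) ∧
        (∀ M : S →* ℕ+,
          (∀ s : RightLCM.NoncoreIrreducible S,
            ((M s : ℕ) : ℕ∞) = (RightLCM.coIndex s).verts.encard) → M = N)) := by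
  refine ⟨⟨?_, ?_⟩, ?_⟩
  · rintro ⟨N, hN⟩
    exact ⟨hN.freelyGenerates, hN.edgeFreeCoComponents, hN.noncoreFactorable,
      hN.balancedFactorization⟩
  · rintro ⟨hF, hE, hfac, hB⟩
    obtain ⟨N, hN, -⟩ := RightLCM.exists_isGeneralizedScale hF hE hfac hB
    exact ⟨N, hN⟩
  · rintro ⟨hF, hE, hfac, hB⟩
    obtain ⟨N, hN, hval⟩ := RightLCM.exists_isGeneralizedScale hF hE hfac hB
    exact ⟨N, hN, hval,
      fun M hM => RightLCM.monoidHom_eq_of_map_eq_encard hF hE hfac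
        (fun s => (hM.encard_verts s).symm) hval,
      fun M hM => RightLCM.monoidHom_eq_of_map_eq_encard hF hE hfac hM hval⟩
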